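/- Let $n\ge 2$, $T=\mathbb{Q}[[x_1,\dots,x_n]]$ and $M=(x_1,\dots,x_n)T$. A subring $R\subseteq T$ is called quasi-local with maximal ideal $R\cap M$ if $R\cap M$ is its unique maximal ideal; for such an $R$ and $u\in T$ the localization $R[u]_{R[u]\cap M}$ is regarded as a subring of $T$. Call a subring $S\subseteq T$ a base ring if it is countable, Noetherian and quasi-local with maximal ideal $S\cap M$, contains $\mathbb{Q}[x_1,\dots,x_n]$, has completion $T$ (compatibly with the inclusion $S\subseteq T$; hence $S$ is a regular local ring), and contains all its factors: whenever $0\ne r\in S$ lies in $pT$ for a prime element $p$ of $T$, then $pu\in S$ for some unit $u$ of $T$. For a base ring $S$, an $S^\star$-subring of $T$ is a ring $R$ with $S\subseteq R\subseteq T$ such that every $P\in\operatorname{Spec} T$ with $P\cap S=(0)$ satisfies $P\cap R=(0)$; a $CS^\star$-subring is a countable $S^\star$-subring that is quasi-local with maximal ideal $R\cap M$. **Theorem.** Base rings exist, and for every base ring $S$ the following hold. (1) Let $R$ be a $CS^\star$-subring of $T$ and let $A_1,A_2,\dots\in(x_1,\dots,x_n)R$ be such that whenever $i>j$ there is a $k$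 with $A_i\in M^k$ and $A_j\notin M^k$. Then there are nonzero $z_1,z_2,\dots\in(x_1,\dots,x_n)S$ such that the ($M$-adically convergent) series $$u=1+A_1z_1+A_2z_1z_2+\cdots+A_kz_1z_2\cdots z_k+\cdots$$ is a unit of $T$ and $R[u]_{R[u]\cap M}$ is a $CS^\star$-subring of $T$. (2) There are $CS^\star$-subrings $S_c$ of $T$, for all ordinals $c<\omega_1$, and subrings $A\subseteq B$ of $T$ such that: (a) $S_0=S$; for every $c<\omega_1$ we have $S_{c+1}=S_c[u]_{S_c[u]\cap M}$ for some $u\notin S_c$ that is a unit of $T$ of the form in (1), with $R=S_c$, nonzero $z_i\in(x_1,\dots,x_n)S$ and $A_i\in(x_1,\dots,x_n)S_c$ subject to the condition in (1); and $S_c=\bigcup_{b<c}S_b$ for limit ordinals $c<\omega_1$; (b) $A=\bigcup_{c<\omega_1}S_c$ is an uncountable $S^\star$-subring of $T$ that is quasi-local with maximal ideal $A\cap M$; (c) $B$ is an uncountable $S^\star$-subring of $T$ (so $S\subseteq B\subseteq T$, and every prime ideal of $T$ that meets $S$ only in $0$ meets $B$ only in $0$), quasi-local with maximal ideal $B\cap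 M$; every element of $B$ is a quotient of two elements of $A$; and $bT\cap B=bB$ for every $b\in B$. -/

import Mathlib

noncomputable section

/-- The power series ring `T = ℚ[[x_1, …, x_n]]`. -/
abbrev PowSer (n : ℕ) : Type := MvPowerSeries (Fin n) ℚ

/-- The maximal ideal `M = (x_1, …, x_n)T` of `T`. -/
def maxIdealT (n : ℕ) : Ideal (PowSer n) :=
  Ideal.span (Set.range (fun j : Fin n => (MvPowerSeries.X j : PowSer n)))

theorem mem_maxIdealT_iff {n : ℕ} (f : PowSer n) :
    f ∈ maxIdealT n ↔ MvPowerSeries.constantCoeff f = 0 := by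
  classical
  constructor
  · intro hf
    have hle : maxIdealT n ≤ RingHom.ker (MvPowerSeries.constantCoeff (σ := Fin n) (R := ℚ)) := by
      refine Ideal.span_le.2 ?_
      rintro _ ⟨j, rfl⟩
      simp [RingHom.mem_ker]
    exact hle hf
  · intro hf
    have hch : ∀ m : Fin n →₀ ℕ, m ≠ 0 → ∃ j, m j ≠ 0 := by
      intro m hm
      by_contra! h
      exact hm (Finsupp.ext h)
    let c : (Fin n →₀ ℕ) → Option (Fin n) :=
      fun m => if h : m ≠ 0 then some (hch m h).choose else none
    let g : Fin n → PowSer n := fun j m => if c m = some j then MvPowerSeries.coeff m f else 0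
    have hg : ∀ j m, MvPowerSeries.coeff m (g j)
        = if c m = some j then MvPowerSeries.coeff m f else 0 := fun _ _ => rfl
    have hfg : f = ∑ j, g j := by
      ext m
      rw [map_sum]
      simp only [hg]
      by_cases hm : m = 0
      · subst hm
        have h0 : MvPowerSeries.coeff 0 f = 0 := by
          rw [MvPowerSeries.coeff_zero_eq_constantCoeff_apply]; exact hf
        simp [h0]
      · have hc : c m = some (hch m hm).choose := by simp [c, hm]
        rw [hc]
        simp
    rw [hfg]
    refine Ideal.sum_mem _ fun j _ => ?_
    have hdvd : (MvPowerSeries.X j : PowSer n) ∣ g j := by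
      rw [MvPowerSeries.X_dvd_iff]
      intro m hm
      rw [hg]
      refine if_neg fun hcm => ?_
      by_cases h0 : m ≠ 0
      · have hc : c m = some (hch m h0).choose := by simp [c, h0]
        rw [hc] at hcm
        have hj : (hch m h0).choose = j := by simpa using hcm
        exact (hch m h0).choose_spec (hj ▸ hm)
      · have hc : c m = none := by simp [c, h0]
        simp [hc] at hcm
    exact Ideal.mem_of_dvd _ hdvd (Ideal.subset_span ⟨j, rfl⟩)

theorem maxIdealT_isPrime (n : ℕ) : (maxIdealT n).IsPrime := by
  refine ⟨?_, ?_⟩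
  · rw [Ideal.ne_top_iff_one, mem_maxIdealT_iff]
    simp
  · intro a b h
    simpa [mem_maxIdealT_iff] using h

/-- `R` is quasi-local with maximal ideal `R ∩ M`: the maximal ideals of `R` are exactly
the one ideal `R ∩ M`. -/
def IsQuasiLocalSub {n : ℕ} (R : Subring (PowSer n)) : Prop :=
  ∀ I : Ideal R, I.IsMaximal ↔ I = (maxIdealT n).comap R.subtype

/-- `R` contains all its factors: if a nonzero `r ∈ R` lies in `pT` for a prime element `p` of
`T`, then `pu ∈ R` for some unit `u` of `T`. -/
def ContainsAllFactors {n : ℕ} (R : Subring (PowSer n)) : Prop :=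
  ∀ r ∈ R, r ≠ 0 → ∀ p : PowSer n, Prime p → r ∈ Ideal.span {p} →
    ∃ u : PowSer n, IsUnit u ∧ p * u ∈ R

/-- The base rings `S`: countable Noetherian quasi-local subrings `(S, S ∩ M)` of `T` that contain
`ℚ[x_1, …, x_n]`, have completion `T` and contain all their factors. -/
structure IsBaseRing {n : ℕ} (S : Subring (PowSer n)) : Prop where
  countable : Countable S
  noetherian : IsNoetherianRing S
  quasiLocal : IsQuasiLocalSub S
  polynomials_le :
    (MvPolynomial.coeToMvPowerSeries.ringHom (σ := Fin n) (R := ℚ)).range ≤ S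
  /-- The completion of `S` at its maximal ideal is `T`, compatibly with the inclusion `S ⊆ T`. -/
  completion :
    Nonempty (AdicCompletion ((maxIdealT n).comap S.subtype) S ≃ₐ[S] PowSer n)
  factors : ContainsAllFactors S

/-- `R` is an `S^⋆`-subring of `T`. -/
structure IsSStarSubring {n : ℕ} (S R : Subring (PowSer n)) : Prop where
  le : S ≤ R
  inter_eq_bot : ∀ P : Ideal (PowSer n), P.IsPrime →
    P.comap S.subtype = ⊥ → P.comap R.subtype = ⊥

/-- `R` is a `CS^⋆`-subring of `T`: a countable quasi-local `S^⋆`-subring with maximal ideal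
`R ∩ M`. -/
structure IsCSStarSubring {n : ℕ} (S R : Subring (PowSer n)) : Prop where
  countable : Countable R
  quasiLocal : IsQuasiLocalSub R
  sStar : IsSStarSubring S R

/-- The ideal `(x_1, …, x_n)R` of a subring `R` of `T` that contains the variables. -/
def varIdeal {n : ℕ} (R : Subring (PowSer n)) : Ideal R :=
  Ideal.span {r : R | ∃ j : Fin n, (r : PowSer n) = MvPowerSeries.X j}

/-- The localization `R_{R ∩ M}`, as a subring of `T` (elements of `R` outside `M` are units
of `T`): all `t ∈ T` with `t = a / b` for some `a, b ∈ R`, `b ∉ M`. -/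
def localizeAtM {n : ℕ} (R : Subring (PowSer n)) : Subring (PowSer n) where
  carrier := {t | ∃ a ∈ R, ∃ b ∈ R, b ∉ maxIdealT n ∧ t * b = a}
  one_mem' := ⟨1, R.one_mem, 1, R.one_mem,
    (Ideal.ne_top_iff_one _).1 (maxIdealT_isPrime n).ne_top, by ring⟩
  zero_mem' := ⟨0, R.zero_mem, 1, R.one_mem,
    (Ideal.ne_top_iff_one _).1 (maxIdealT_isPrime n).ne_top, by ring⟩
  mul_mem' := by
    rintro s t ⟨a, ha, b, hb, hbM, h⟩ ⟨a', ha', b', hb', hbM', h'⟩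
    refine ⟨a * a', R.mul_mem ha ha', b * b', R.mul_mem hb hb', fun hm => ?_, ?_⟩
    · exact ((maxIdealT_isPrime n).mem_or_mem hm).elim hbM hbM'
    · rw [← h, ← h']; ring
  add_mem' := by
    rintro s t ⟨a, ha, b, hb, hbM, h⟩ ⟨a', ha', b', hb', hbM', h'⟩
    refine ⟨a * b' + a' * b, R.add_mem (R.mul_mem ha hb') (R.mul_mem ha' hb),
      b * b', R.mul_mem hb hb', fun hm => ?_, ?_⟩
    · exact ((maxIdealT_isPrime n).mem_or_mem hm).elim hbM hbM'
    · rw [← h, ← h']; ring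
  neg_mem' := by
    rintro s ⟨a, ha, b, hb, hbM, h⟩
    exact ⟨-a, R.neg_mem ha, b, hb, hbM, by rw [← h]; ring⟩

/-- The ring `R[u]_{R[u] ∩ M}`. -/
def adjoinLocal {n : ℕ} (R : Subring (PowSer n)) (u : PowSer n) : Subring (PowSer n) :=
  localizeAtM (Algebra.adjoin R {u}).toSubring

/-- The sequence `A` has entries in `(x_1, …, x_n)R`, and whenever `i > j` there is a `k` with
`A_i ∈ M^k` and `A_j ∉ M^k`. -/
def IsAdmissible {n : ℕ} {R : Subring (PowSer n)} (A : ℕ → R) : Prop :=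
  (∀ i, A i ∈ varIdeal R) ∧
    ∀ i j, j < i → ∃ k : ℕ, (A i : PowSer n) ∈ maxIdealT n ^ k ∧
      (A j : PowSer n) ∉ maxIdealT n ^ k

/-- `u = 1 + A_1 z_1 + A_2 z_1 z_2 + ⋯`, a series that converges to `u` in the `M`-adic topology;
`A i` and `z i` stand for `A_{i+1}` and `z_{i+1}`. -/
def IsSeriesSum {n : ℕ} (A z : ℕ → PowSer n) (u : PowSer n) : Prop :=
  ∀ k : ℕ, ∃ N : ℕ, ∀ m ≥ N,
    u - (1 + ∑ i ∈ Finset.range m, A i * ∏ j ∈ Finset.range (i + 1), z j) ∈ maxIdealT n ^ k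

/-- `z` is a sequence of nonzero elements of `(x_1, …, x_n)S`, `u` is a unit of `T` equal to
`1 + A_1 z_1 + A_2 z_1 z_2 + ⋯`, and `R[u]_{R[u] ∩ M}` is a `CS^⋆`-subring of `T`. -/
structure IsAdjoinableUnit {n : ℕ} (S R : Subring (PowSer n)) (A : ℕ → R) (z : ℕ → S)
    (u : PowSer n) : Prop where
  z_mem : ∀ i, z i ∈ varIdeal S
  z_ne_zero : ∀ i, z i ≠ 0
  isUnit : IsUnit u
  isSum : IsSeriesSum (fun i => (A i : PowSer n)) (fun i => (z i : PowSer n)) u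
  csStar : IsCSStarSubring S (adjoinLocal R u)

/-- An `ω₁`-chain of `CS^⋆`-subrings `R 0 = S ⊊ R 1 ⊊ ⋯`: each successor stage adjoins a unit
`u = 1 + A_1 z_1 + A_2 z_1 z_2 + ⋯` outside the current ring and localizes, limit stages are
unions. -/
structure IsUnitChain {n : ℕ} (S : Subring (PowSer n)) (R : Ordinal.{0} → Subring (PowSer n)) :
    Prop where
  zero : R 0 = S
  csStar : ∀ c < Ordinal.omega 1, IsCSStarSubring S (R c)
  succ : ∀ c < Ordinal.omega 1, ∃ (A : ℕ → R c) (z : ℕ → S) (u : PowSer n),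
    IsAdmissible A ∧ IsAdjoinableUnit S (R c) A z u ∧ u ∉ R c ∧
      R (Order.succ c) = adjoinLocal (R c) u
  limit : ∀ c < Ordinal.omega 1, Order.IsSuccLimit c →
    (R c : Set (PowSer n)) = ⋃ b < c, (R b : Set (PowSer n))

end

noncomputable section

open Polynomial

/-! The condition on primes becomes one on divisibility: an overring `R` of `S` is an `S^⋆`-subring
exactly when each nonzero element of `R` divides, in `T`, a nonzero element of `S`
(`isSStarSubring_iff`). In this form it passes to directed unions, to localizations at `M` and to
rings of fractions inside `T`.

The core is `exists_generic_unit`. Let `U_k` be the partial sums of `u`, let `F_0, F_1, …` enumerate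
the polynomials over the countable ring `R`, and for `r` in `R` nonzero let `σ(r)` be a nonzero
multiple of `r` in `S`. Take `z_k = X · ∏_{i ≤ k} σ(F_i(U_k))`. Since `z_k` divides `u - U_k`, it
divides `F_i(u) - F_i(U_k)`. If `F_i(U_k) ≠ 0` and `i ≤ k`, then `F_i(u)` is `F_i(U_k)` times an
element of `1 + M`, so it divides `σ(F_i(U_k))`. Admissibility makes the `U_k` distinct, so a
nonzero `F_i` misses some `U_k` with `k ≥ i`. Hence `u` is transcendental over `R`, and its
adjunction preserves the divisibility condition.

Iterating along `ω₁` gives `A`, and `B` is the intersection of `T` with the fraction field of `A`;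
there `bT ∩ B = bB` is immediate. A base ring is a countable subalgebra of `T` closed under choosing
coefficients of linear relations and representatives of prime factors (`exists_isBaseRing`). -/

/-! ### The `M`-adic topology and quasi-local subrings -/

instance maxIdealT_isAdicComplete (n : ℕ) : IsAdicComplete (maxIdealT n) (PowSer n) :=
  inferInstanceAs (IsAdicComplete (Ideal.span (Set.range MvPowerSeries.X)) _)

theorem isUnit_iff_notMem_maxIdealT {n : ℕ} {x : PowSer n} : IsUnit x ↔ x ∉ maxIdealT n := by
  rw [mem_maxIdealT_iff, MvPowerSeries.isUnit_iff_constantCoeff, isUnit_iff_ne_zero]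

theorem X_mem_maxIdealT {n : ℕ} (j : Fin n) : (MvPowerSeries.X j : PowSer n) ∈ maxIdealT n :=
  Ideal.subset_span ⟨j, rfl⟩

theorem mvPowerSeries_X_ne_zero {n : ℕ} (j : Fin n) :
    (MvPowerSeries.X j : PowSer n) ≠ 0 := by
  intro h
  have h1 := MvPowerSeries.coeff_index_single_self_X (R := ℚ) j
  rw [h, map_zero] at h1
  exact zero_ne_one h1

theorem eq_zero_of_forall_mem_pow {n : ℕ} {x : PowSer n} (h : ∀ k, x ∈ maxIdealT n ^ k) :
    x = 0 :=
  IsHausdorff.haus (I := maxIdealT n) inferInstance x fun k => by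
    rw [SModEq.zero]; simpa using h k

/-- A series whose `i`-th term lies in `M ^ i` converges. -/
theorem exists_series_sum {n : ℕ} (a : ℕ → PowSer n) (ha : ∀ i, a i ∈ maxIdealT n ^ i) :
    ∃ u : PowSer n, ∀ m, u - ∑ i ∈ Finset.range m, a i ∈ maxIdealT n ^ m := by
  obtain ⟨u, hu⟩ := IsPrecomplete.prec (I := maxIdealT n) (M := PowSer n) inferInstance
    (f := fun m => ∑ i ∈ Finset.range m, a i) (by
      intro m k hmk
      rw [SModEq.sub_mem, smul_eq_mul, Ideal.mul_top, ← neg_mem_iff, neg_sub,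
        ← Finset.sum_range_add_sum_Ico _ hmk, add_sub_cancel_left]
      exact Ideal.sum_mem _ fun i hi =>
        Ideal.pow_le_pow_right (Finset.mem_Ico.1 hi).1 (ha i))
  refine ⟨u, fun m => ?_⟩
  have := hu m
  rwa [SModEq.sub_mem, smul_eq_mul, Ideal.mul_top, ← neg_mem_iff, neg_sub] at this

theorem isQuasiLocalSub_of_forall_exists_inv {n : ℕ} {R : Subring (PowSer n)}
    (h : ∀ x ∈ R, x ∉ maxIdealT n → ∃ y ∈ R, x * y = 1) : IsQuasiLocalSub R := by
  have hle : ∀ I : Ideal R, I ≠ ⊤ → I ≤ (maxIdealT n).comap R.subtype := by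
    intro I hI x hx
    by_contra hxM
    obtain ⟨y, hy, hxy⟩ := h x x.2 hxM
    refine hI ((Ideal.eq_top_iff_one _).2 ?_)
    have h1 : x * ⟨y, hy⟩ = 1 := Subtype.ext hxy
    exact h1 ▸ I.mul_mem_right _ hx
  have htop : (maxIdealT n).comap R.subtype ≠ ⊤ := by
    have := maxIdealT_isPrime n
    exact (Ideal.comap_isPrime R.subtype (maxIdealT n)).ne_top
  have hmax : ((maxIdealT n).comap R.subtype).IsMaximal := by
    refine ⟨⟨htop, fun J hJ => ?_⟩⟩
    by_contra hJt
    exact (hJ.trans_le (hle J hJt)).ne rfl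
  intro I
  refine ⟨fun hI => hI.eq_of_le htop (hle I hI.ne_top), ?_⟩
  rintro rfl
  exact hmax

theorem IsQuasiLocalSub.exists_inv {n : ℕ} {R : Subring (PowSer n)} (h : IsQuasiLocalSub R)
    {x : PowSer n} (hx : x ∈ R) (hxM : x ∉ maxIdealT n) : ∃ y ∈ R, x * y = 1 := by
  by_contra hne
  have hnu : ¬ IsUnit (⟨x, hx⟩ : R) := by
    intro hu
    obtain ⟨y, hy⟩ := hu.exists_right_inv
    exact hne ⟨y, y.2, congrArg Subtype.val hy⟩
  obtain ⟨I, hI, hxI⟩ := exists_max_ideal_of_mem_nonunits hnu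
  rw [(h I).1 hI] at hxI
  exact hxM hxI

/-! ### The divisibility criterion and localized simple extensions -/

/-- `R` is an `S^⋆`-subring iff it contains `S` and each nonzero element of `R` divides a nonzero
element of `S` in `T`. -/
theorem isSStarSubring_iff {n : ℕ} {S R : Subring (PowSer n)} :
    IsSStarSubring S R ↔ S ≤ R ∧ ∀ r ∈ R, r ≠ 0 → ∃ s ∈ S, s ≠ 0 ∧ r ∣ s := by
  constructor
  · intro h
    refine ⟨h.le, fun r hr hr0 => ?_⟩
    by_contra hne
    push Not at hne
    -- If `r` divides no nonzero element of `S`, some prime contains `r` and avoids `S \ {0}`,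
    -- against the hypothesis on primes.
    let N : Submonoid (PowSer n) := S.toSubmonoid ⊓ nonZeroDivisors (PowSer n)
    have hd : Disjoint (Ideal.span {r} : Set (PowSer n)) N := by
      refine Set.disjoint_left.2 fun s hs hsN => ?_
      exact hne s hsN.1 (nonZeroDivisors.ne_zero hsN.2) (Ideal.mem_span_singleton.1 hs)
    obtain ⟨P, hP, hle, hPN⟩ := Ideal.exists_le_prime_disjoint _ _ hd
    have hPS : P.comap S.subtype = ⊥ := by
      refine (Submodule.eq_bot_iff _).2 fun s hs => ?_
      by_contra hs0
      exact Set.disjoint_left.1 hPN hs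
        ⟨s.2, mem_nonZeroDivisors_of_ne_zero fun h0 => hs0 (Subtype.ext h0)⟩
    have hPR := h.inter_eq_bot P hP hPS
    have hrP : (⟨r, hr⟩ : R) ∈ P.comap R.subtype :=
      hle (Ideal.mem_span_singleton_self r)
    rw [hPR] at hrP
    exact hr0 (congrArg Subtype.val hrP)
  · rintro ⟨hle, h⟩
    refine ⟨hle, fun P hP hPS => (Submodule.eq_bot_iff _).2 fun r hr => ?_⟩
    by_contra hr0
    obtain ⟨s, hs, hs0, hrs⟩ := h r r.2 fun h0 => hr0 (Subtype.ext h0)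
    have hsP : (⟨s, hs⟩ : S) ∈ P.comap S.subtype := P.mem_of_dvd hrs hr
    rw [hPS] at hsP
    exact hs0 (congrArg Subtype.val hsP)

theorem le_localizeAtM {n : ℕ} (R : Subring (PowSer n)) : R ≤ localizeAtM R := fun x hx =>
  ⟨x, hx, 1, R.one_mem, (Ideal.ne_top_iff_one _).1 (maxIdealT_isPrime n).ne_top, mul_one x⟩

theorem localizeAtM_isQuasiLocalSub {n : ℕ} (R : Subring (PowSer n)) :
    IsQuasiLocalSub (localizeAtM R) := by
  refine isQuasiLocalSub_of_forall_exists_inv ?_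
  rintro x ⟨a, ha, b, hb, hbM, h⟩ hxM
  obtain ⟨y, hy⟩ := (isUnit_iff_notMem_maxIdealT.2 hxM).exists_right_inv
  refine ⟨y, ⟨b, hb, a, ha, fun haM => ?_, ?_⟩, hy⟩
  · rw [← h] at haM
    exact ((maxIdealT_isPrime n).mem_or_mem haM).elim hxM hbM
  · rw [← h, ← mul_assoc, mul_comm y, hy, one_mul]

theorem localizeAtM_countable {n : ℕ} (R : Subring (PowSer n)) [Countable R] :
    Countable (localizeAtM R) := by
  have h : ∀ x : localizeAtM R, ∃ p : R × R, (p.2 : PowSer n) ∉ maxIdealT n ∧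
      (x : PowSer n) * p.2 = p.1 := by
    rintro ⟨x, a, ha, b, hb, hbM, h⟩
    exact ⟨(⟨a, ha⟩, ⟨b, hb⟩), hbM, h⟩
  choose p hpM hp using h
  refine Function.Injective.countable (f := p) fun x y hxy => Subtype.ext ?_
  have hx := hp x
  rw [hxy, ← hp y] at hx
  exact (isUnit_iff_notMem_maxIdealT.2 (hpM y)).mul_left_injective hx

theorem le_adjoinLocal {n : ℕ} (R : Subring (PowSer n)) (u : PowSer n) : R ≤ adjoinLocal R u :=
  fun x hx => le_localizeAtM _ ((Algebra.adjoin R {u}).algebraMap_mem (⟨x, hx⟩ : R))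

theorem mem_adjoinLocal_self {n : ℕ} (R : Subring (PowSer n)) (u : PowSer n) :
    u ∈ adjoinLocal R u :=
  le_localizeAtM _ (Algebra.self_mem_adjoin_singleton R u)

theorem adjoinLocal_countable {n : ℕ} (R : Subring (PowSer n)) [Countable R] (u : PowSer n) :
    Countable (adjoinLocal R u) := by
  have : Countable (Algebra.adjoin R {u}).toSubring := by
    refine Cardinal.mk_le_aleph0_iff.1 ((Algebra.cardinalMk_adjoin_le R {u}).trans ?_)
    simp
  exact localizeAtM_countable _

/-- If the value at `u` of every nonzero polynomial over `R` divides a nonzero element of `S`,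
then `R[u]_{R[u] ∩ M}` is a `CS^⋆`-subring. -/
theorem adjoinLocal_isCSStarSubring {n : ℕ} {S R : Subring (PowSer n)} [Countable R]
    (hSR : S ≤ R) {u : PowSer n}
    (h : ∀ f : R[X], f ≠ 0 → ∃ s ∈ S, s ≠ 0 ∧ aeval u f ∣ s) :
    IsCSStarSubring S (adjoinLocal R u) := by
  refine ⟨adjoinLocal_countable R u, localizeAtM_isQuasiLocalSub _,
    isSStarSubring_iff.2 ⟨hSR.trans (le_adjoinLocal R u), ?_⟩⟩
  rintro x ⟨a, ha, b, hb, hbM, hab⟩ hx0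
  have ha' : a ∈ Algebra.adjoin R {u} := ha
  rw [Algebra.adjoin_singleton_eq_range_aeval] at ha'
  obtain ⟨f, rfl⟩ := ha'
  have hf : f ≠ 0 := by
    rintro rfl
    have hb0 : b ≠ 0 := by rintro rfl; exact hbM (Ideal.zero_mem _)
    simp [hx0, hb0] at hab
  obtain ⟨s, hs, hs0, hd⟩ := h f hf
  exact ⟨s, hs, hs0, (Dvd.intro b hab).trans hd⟩

/-! ### Series with prescribed approximations and the generic unit -/

/-- Partial products and partial sums of the series `1 + A_1 z_1 + A_2 z_1 z_2 + ⋯`, where `z_k` is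
a prescribed function of the preceding partial sum. -/
def partialData {n : ℕ} {S R : Subring (PowSer n)} (hSR : S ≤ R) (A : ℕ → R) (Z : ℕ → R → S) :
    ℕ → S × R
  | 0 => (1, 1)
  | k + 1 =>
    ((partialData hSR A Z k).1 * Z k (partialData hSR A Z k).2,
      (partialData hSR A Z k).2 + A k * Subring.inclusion hSR
        ((partialData hSR A Z k).1 * Z k (partialData hSR A Z k).2))

theorem partialData_spec {n : ℕ} {S R : Subring (PowSer n)} (hSR : S ≤ R) (A : ℕ → R)
    (Z : ℕ → R → S) (k : ℕ) :
    let z : ℕ → S := fun i => Z i (partialData hSR A Z i).2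
    ((partialData hSR A Z k).1 : PowSer n) = ∏ j ∈ Finset.range k, (z j : PowSer n) ∧
      ((partialData hSR A Z k).2 : PowSer n) =
        1 + ∑ i ∈ Finset.range k, (A i : PowSer n) * ∏ j ∈ Finset.range (i + 1),
          (z j : PowSer n) := by
  intro z
  induction k with
  | zero => simp [partialData]
  | succ k ih =>
    constructor
    · rw [Finset.prod_range_succ, ← ih.1]; rfl
    · rw [Finset.sum_range_succ, ← add_assoc, ← ih.2, Finset.prod_range_succ, ← ih.1]; rfl

/-- The `k`-th partial sum differs from the sum by a multiple of `z_k`. -/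
theorem dvd_sub_partialSum {n : ℕ} {A z : ℕ → PowSer n} (hz : ∀ i, z i ∈ maxIdealT n)
    {u : PowSer n}
    (hu : ∀ m, u - (1 + ∑ i ∈ Finset.range m, A i * ∏ j ∈ Finset.range (i + 1), z j) ∈
      maxIdealT n ^ m) (k : ℕ) :
    z k ∣ u - (1 + ∑ i ∈ Finset.range k, A i * ∏ j ∈ Finset.range (i + 1), z j) := by
  have hprod : ∀ (i : ℕ) (y : ℕ → PowSer n), (∀ j, y j ∈ maxIdealT n) →
      ∏ j ∈ Finset.range i, y j ∈ maxIdealT n ^ i := by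
    intro i y hy
    simpa using Ideal.prod_mem_prod (s := Finset.range i) (I := fun _ => maxIdealT n)
      fun j _ => hy j
  -- The quotient is the tail of the series with the factor `z k` deleted from every term; the
  -- factors `z j` with `j > k` still make it converge.
  obtain ⟨v, hv⟩ := exists_series_sum
    (fun i => A (k + i) * (∏ j ∈ Finset.range k, z j) * ∏ j ∈ Finset.range i, z (k + 1 + j))
    fun i => Ideal.mul_mem_left _ _ (hprod i _ fun j => hz _)
  refine ⟨v, sub_eq_zero.1 (eq_zero_of_forall_mem_pow fun m => ?_)⟩
  have h1 := Ideal.pow_le_pow_right (Nat.le_add_left m k) (hu (k + m))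
  have h2 := Ideal.mul_mem_left _ (z k) (hv m)
  convert sub_mem h1 h2 using 1
  rw [Finset.sum_range_add, mul_sub, Finset.mul_sum]
  have h3 : ∀ i, z k * (A (k + i) * (∏ j ∈ Finset.range k, z j) *
      ∏ j ∈ Finset.range i, z (k + 1 + j)) =
      A (k + i) * ∏ j ∈ Finset.range (k + i + 1), z j := by
    intro i
    rw [show k + i + 1 = k + 1 + i by ring, Finset.prod_range_add, Finset.prod_range_succ]
    ring
  simp only [h3]
  ring

/-- The partial sums of an admissible series are pairwise distinct. -/
theorem partialSum_injective {n : ℕ} {A z : ℕ → PowSer n} (hz0 : ∀ i, z i ≠ 0)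
    (hA : ∀ i j, j < i → ∃ k : ℕ, A i ∈ maxIdealT n ^ k ∧ A j ∉ maxIdealT n ^ k) :
    Function.Injective fun k =>
      1 + ∑ i ∈ Finset.range k, A i * ∏ j ∈ Finset.range (i + 1), z j := by
  suffices hlt : ∀ j k, j < k → ¬ (1 + ∑ i ∈ Finset.range j, A i * ∏ j ∈ Finset.range (i + 1), z j =
      1 + ∑ i ∈ Finset.range k, A i * ∏ j ∈ Finset.range (i + 1), z j) by
    intro j k h
    rcases lt_trichotomy j k with hjk | hjk | hjk
    exacts [(hlt j k hjk h).elim, hjk, (hlt k j hjk h.symm).elim]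
  intro j k hjk heq
  -- All later `A i` lie in `M ^ K` while `A j` does not, so the terms after `A j` cannot cancel it.
  obtain ⟨K, hK1, hK⟩ := hA (j + 1) j j.lt_succ_self
  have hmem : ∀ i, j + 1 ≤ i → A i ∈ maxIdealT n ^ K := by
    intro i hi
    induction i, hi using Nat.le_induction with
    | base => exact hK1
    | succ i hi ih =>
      obtain ⟨L, hL1, hL⟩ := hA (i + 1) i i.lt_succ_self
      rcases le_total K L with h | h
      · exact Ideal.pow_le_pow_right h hL1
      · exact absurd (Ideal.pow_le_pow_right h ih) hL
  have key : ∀ k, j + 1 ≤ k → ∃ c ∈ maxIdealT n ^ K,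
      ∑ i ∈ Finset.range k, A i * ∏ j ∈ Finset.range (i + 1), z j =
        ∑ i ∈ Finset.range j, A i * ∏ j ∈ Finset.range (i + 1), z j +
          (∏ i ∈ Finset.range (j + 1), z i) * (A j + c) := by
    intro k hk
    induction k, hk using Nat.le_induction with
    | base => exact ⟨0, Ideal.zero_mem _, by rw [Finset.sum_range_succ]; ring⟩
    | succ k hk ih =>
      obtain ⟨c, hc, ih⟩ := ih
      obtain ⟨d, hd⟩ : (∏ i ∈ Finset.range (j + 1), z i) ∣ ∏ i ∈ Finset.range (k + 1), z i :=
        Finset.prod_dvd_prod_of_subset _ _ _ (Finset.range_mono (by omega))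
      refine ⟨c + A k * d, add_mem hc (Ideal.mul_mem_right _ _ (hmem k hk)), ?_⟩
      rw [Finset.sum_range_succ, ih, hd]
      ring
  obtain ⟨c, hc, h⟩ := key k hjk
  replace heq := add_left_cancel heq
  rw [heq, left_eq_add] at h
  have h0 := (mul_eq_zero.1 h).resolve_left (Finset.prod_ne_zero_iff.2 fun i _ => hz0 i)
  rw [add_eq_zero_iff_eq_neg.1 h0] at hK
  exact hK (neg_mem hc)

/-- A diagonal argument: every polynomial is handled by all but finitely many `z k`, and its value
at `u` is a unit multiple of its value at a partial sum. The nonvanishing clause later shows that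
`u` lies outside `R`. -/
theorem exists_generic_unit {n : ℕ} (x : Fin n) {S R : Subring (PowSer n)} [Countable R]
    (hx : (MvPowerSeries.X x : PowSer n) ∈ S) (hSR : S ≤ R)
    (hdvd : ∀ r ∈ R, r ≠ 0 → ∃ s ∈ S, s ≠ 0 ∧ r ∣ s) (A : ℕ → R)
    (hA : ∀ i j, j < i → ∃ k : ℕ, (A i : PowSer n) ∈ maxIdealT n ^ k ∧
      (A j : PowSer n) ∉ maxIdealT n ^ k) :
    ∃ (z : ℕ → S) (u : PowSer n), (∀ i, z i ∈ varIdeal S) ∧ (∀ i, z i ≠ 0) ∧ IsUnit u ∧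
      IsSeriesSum (fun i => (A i : PowSer n)) (fun i => (z i : PowSer n)) u ∧
      ∀ f : R[X], f ≠ 0 → aeval u f ≠ 0 ∧ ∃ s ∈ S, s ≠ 0 ∧ aeval u f ∣ s := by
  classical
  have hs : ∀ r : R, ∃ s : S, s ≠ 0 ∧ (r ≠ 0 → (r : PowSer n) ∣ s) := by
    intro r
    by_cases hr : r = 0
    · exact ⟨1, one_ne_zero, fun h => absurd hr h⟩
    · obtain ⟨s, hs, hs0, hd⟩ := hdvd r r.2 fun h => hr (Subtype.ext h)
      exact ⟨⟨s, hs⟩, fun h => hs0 (congrArg Subtype.val h), fun _ => hd⟩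
  have : IsDomain (PowSer n) := NoZeroDivisors.to_isDomain _
  choose σ hσ0 hσ using hs
  have : Countable R[X] := Cardinal.mk_le_aleph0_iff.1 (cardinalMk_le_max.trans (by simp))
  obtain ⟨F, hF⟩ := exists_surjective_nat R[X]
  let X₀ : S := ⟨MvPowerSeries.X x, hx⟩
  have hX₀ : X₀ ≠ 0 := fun h => mvPowerSeries_X_ne_zero x (congrArg Subtype.val h)
  have hX₀mem : X₀ ∈ varIdeal S := Ideal.subset_span ⟨x, rfl⟩
  -- The factor `X₀` puts `z k` in `M` and makes the correcting factor below a unit. As `σ` is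
  -- nonzero even at `0`, roots of `F i` do no harm.
  let Z : ℕ → R → S := fun k r => X₀ * ∏ i ∈ Finset.range (k + 1), σ ((F i).eval r)
  let U : ℕ → R := fun i => (partialData hSR A Z i).2
  let z : ℕ → S := fun i => Z i (U i)
  have hz0 : ∀ i, z i ≠ 0 := fun i =>
    mul_ne_zero hX₀ (Finset.prod_ne_zero_iff.2 fun _ _ => hσ0 _)
  have hz0' : ∀ i, (z i : PowSer n) ≠ 0 := fun i h => hz0 i (Subtype.ext h)
  have hzM : ∀ i, (z i : PowSer n) ∈ maxIdealT n := fun i =>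
    Ideal.mul_mem_right _ _ (X_mem_maxIdealT x)
  have hU : ∀ k, (U k : PowSer n) = 1 + ∑ i ∈ Finset.range k,
      (A i : PowSer n) * ∏ j ∈ Finset.range (i + 1), (z j : PowSer n) := fun k =>
    (partialData_spec hSR A Z k).2
  obtain ⟨v, hv⟩ := exists_series_sum
    (fun i => (A i : PowSer n) * ∏ j ∈ Finset.range (i + 1), (z j : PowSer n)) fun i => by
      refine Ideal.mul_mem_left _ _ (Ideal.pow_le_pow_right i.le_succ ?_)
      simpa using Ideal.prod_mem_prod (s := Finset.range (i + 1)) (I := fun _ => maxIdealT n)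
        fun j _ => hzM j
  have hu : ∀ m, 1 + v - (1 + ∑ i ∈ Finset.range m,
      (A i : PowSer n) * ∏ j ∈ Finset.range (i + 1), (z j : PowSer n)) ∈ maxIdealT n ^ m :=
    fun m => by rw [add_sub_add_left_eq_sub]; exact hv m
  have hzu : ∀ k, (z k : PowSer n) ∣ 1 + v - U k := fun k => by
    rw [hU k]
    exact dvd_sub_partialSum hzM hu k
  have hinj : Function.Injective U := by
    intro j k h
    refine partialSum_injective hz0' hA ?_
    simp only [← hU, h]
  have h1M : ∀ y : PowSer n, y ∈ maxIdealT n → IsUnit (1 + y) := fun y hy =>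
    isUnit_iff_notMem_maxIdealT.2 fun h =>
      (Ideal.ne_top_iff_one _).1 (maxIdealT_isPrime n).ne_top ((add_mem_cancel_right hy).1 h)
  refine ⟨z, 1 + v, fun i => Ideal.mul_mem_right _ _ hX₀mem, hz0, h1M v ?_, ?_, ?_⟩
  · have h0 := Ideal.mem_of_dvd _ (hzu 0) (hzM 0)
    rwa [hU 0, Finset.sum_range_zero, add_zero, add_sub_cancel_left] at h0
  · exact fun k => ⟨k, fun m hm => Ideal.pow_le_pow_right hm (hu m)⟩
  · intro f hf
    obtain ⟨i, rfl⟩ := hF f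
    obtain ⟨k, hik, hk⟩ : ∃ k, i ≤ k ∧ (F i).eval (U k) ≠ 0 := by
      by_contra! hne
      refine Set.Ici_infinite i (Set.Finite.subset
        ((finite_setOfPred_isRoot hf).preimage hinj.injOn) fun k hk => hne k hk)
    obtain ⟨d, hd⟩ : ((X₀ * σ ((F i).eval (U k)) : S) : PowSer n) ∣ z k :=
      map_dvd S.subtype (mul_dvd_mul_left X₀ (Finset.dvd_prod_of_mem
        (fun j => σ ((F j).eval (U k))) (Finset.mem_range.2 (Nat.lt_succ_of_le hik))))
    obtain ⟨t, ht⟩ := hσ _ hk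
    obtain ⟨w, hw⟩ := hzu k
    obtain ⟨g, hg⟩ : 1 + v - U k ∣ aeval (1 + v) (F i) - aeval (U k : PowSer n) (F i) := by
      rw [aeval_def, aeval_def, eval₂_eq_eval_map, eval₂_eq_eval_map]
      exact sub_dvd_eval_sub (1 + v) (U k : PowSer n) ((F i).map (algebraMap R (PowSer n)))
    have hval : aeval (U k : PowSer n) (F i) = (((F i).eval (U k) : R) : PowSer n) :=
      (aeval_algebraMap_apply_eq_algebraMap_eval (A := PowSer n) (U k) (F i))
    -- With `r = (F i)(U k)` and `σ r = r * t`, the difference `F i (u) - r` is `X * σ r * d * w *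
    -- g`, so `r` factors out.
    have hfac : aeval (1 + v) (F i) = (((F i).eval (U k) : R) : PowSer n) *
        (1 + MvPowerSeries.X x * (t * d * w * g)) := by
      rw [hval, hw, hd] at hg
      rw [sub_eq_iff_eq_add.1 hg, Subring.coe_mul, ht]
      change (MvPowerSeries.X x : PowSer n) * _ * _ * _ * _ + _ = _
      ring
    obtain ⟨y, hy⟩ := h1M _ (Ideal.mul_mem_right (t * d * w * g) _ (X_mem_maxIdealT x))
    rw [← hy] at hfac
    have hk0 : (((F i).eval (U k) : R) : PowSer n) ≠ 0 := fun h => hk (Subtype.ext h)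
    rw [hfac]
    refine ⟨mul_ne_zero hk0 y.ne_zero, σ ((F i).eval (U k)), (σ _).2,
      fun h => hσ0 _ (Subtype.ext h), ?_⟩
    rw [Units.mul_right_dvd]
    exact ⟨t, ht⟩

/-! ### Countable closed subalgebras and existence of base rings -/

theorem countable_adjoin_rat {T : Type} [CommRing T] [Algebra ℚ T] {Y : Set T}
    (hY : Y.Countable) : (Algebra.adjoin ℚ Y : Set T).Countable := by
  have := hY.to_subtype
  refine Set.countable_coe_iff.1 (Cardinal.mk_le_aleph0_iff.1 ?_)
  exact (Algebra.cardinalMk_adjoin_le ℚ Y).trans (by simp)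

/-- The union of a set `Y` with all values of the operation `g` at arguments in `Y`. -/
def operationHull {T : Type} (g : T → Finset T → Set T) (Y : Set T) : Set T :=
  Y ∪ ⋃ p : Y × Finset Y, g p.1 (p.2.map (Function.Embedding.subtype _))

theorem countable_operationHull {T : Type} {g : T → Finset T → Set T}
    (hg : ∀ r s, (g r s).Countable) {Y : Set T} (hY : Y.Countable) :
    (operationHull g Y).Countable := by
  have := hY.to_subtype
  exact hY.union (Set.countable_iUnion fun p => hg _ _)

theorem subset_operationHull {T : Type} {g : T → Finset T → Set T} {Y : Set T} {r : T}
    (hr : r ∈ Y) {s : Finset T} (hs : (s : Set T) ⊆ Y) : g r s ⊆ operationHull g Y := by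
  classical
  refine fun y hy => Or.inr (Set.mem_iUnion.2 ⟨(⟨r, hr⟩, s.subtype fun x => x ∈ Y), ?_⟩)
  have h : (s.subtype fun x => x ∈ Y).map (Function.Embedding.subtype _) = s :=
    Finset.subtype_map_of_mem hs
  exact h.symm ▸ hy

/-- A chain of `ℚ`-subalgebras, each containing the values of `g` on the previous one. -/
def operationStage {T : Type} [CommRing T] [Algebra ℚ T] (g : T → Finset T → Set T) (X : Set T) :
    ℕ → Subalgebra ℚ T
  | 0 => Algebra.adjoin ℚ X
  | k + 1 => Algebra.adjoin ℚ (operationHull g (operationStage g X k))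

/-- A Löwenheim–Skolem principle: a countable subset of `T` is contained in a countable
`ℚ`-subalgebra closed under a given operation with countable values. -/
theorem exists_countable_closed_subalgebra {T : Type} [CommRing T] [Algebra ℚ T] (X : Set T)
    (hX : X.Countable) (g : T → Finset T → Set T) (hg : ∀ r s, (g r s).Countable) :
    ∃ S : Subalgebra ℚ T, X ⊆ S ∧ Countable S ∧
      ∀ r ∈ S, ∀ s : Finset T, (s : Set T) ⊆ S → g r s ⊆ S := by
  have hsub : ∀ k, operationHull g (operationStage g X k) ⊆ operationStage g X (k + 1) :=
    fun k => Algebra.subset_adjoin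
  have hmono : Monotone (operationStage g X) := monotone_nat_of_le_succ fun k =>
    Set.subset_union_left.trans (hsub k)
  have hcount : ∀ k, (operationStage g X k : Set T).Countable := by
    intro k
    induction k with
    | zero => exact countable_adjoin_rat hX
    | succ k ih => exact countable_adjoin_rat (countable_operationHull hg ih)
  have hco : ((iSup (operationStage g X) : Subalgebra ℚ T) : Set T) =
      ⋃ i, (operationStage g X i : Set T) :=
    Subalgebra.coe_iSup_of_directed hmono.directed_le
  refine ⟨iSup (operationStage g X), ?_, ?_, ?_⟩
  · exact Set.Subset.trans Algebra.subset_adjoin (le_iSup (operationStage g X) 0)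
  · have h := Set.countable_iUnion hcount
    rw [← hco] at h
    exact h.to_subtype
  · intro r hr s hs
    have hr' : r ∈ ((iSup (operationStage g X) : Subalgebra ℚ T) : Set T) := hr
    rw [hco] at hr' hs
    obtain ⟨i, hi⟩ := Set.mem_iUnion.1 hr'
    have hdir : Directed (· ⊆ ·) fun i => (operationStage g X i : Set T) :=
      Monotone.directed_le fun _ _ h => hmono h
    obtain ⟨j, hj⟩ := hdir.exists_mem_subset_of_finset_subset_biUnion hs
    exact ((subset_operationHull (hmono (le_max_left i j) hi)
      (hj.trans (hmono (le_max_right i j)))).trans (hsub _)).trans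
        (le_iSup (operationStage g X) _)

/-- In a Noetherian domain, a nonzero element has, up to associates, countably many prime factors. -/
theorem exists_countable_prime_factors {T : Type*} [CommRing T] [IsDomain T] [IsNoetherianRing T]
    (r : T) (hr : r ≠ 0) : ∃ s : Set T, s.Countable ∧ ∀ p, Prime p → p ∣ r → ∃ q ∈ s,
      Associated p q := by
  obtain ⟨f, hf, hfr⟩ := WfDvdMonoid.exists_factors r hr
  refine ⟨{q | q ∈ f}, (Multiset.finite_toSet f).countable, fun p hp hpr => ?_⟩
  obtain ⟨q, hq, hpq⟩ := hp.exists_mem_multiset_dvd ((hfr.dvd_iff_dvd_right).2 hpr)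
  exact ⟨q, hq, hp.irreducible.associated_of_dvd (hf q hq) hpq⟩

section Closed

variable {n : ℕ} {S : Subring (PowSer n)}

/-- A subring closed under taking coefficients of linear combinations contracts every
extended ideal to itself. -/
theorem comap_map_eq_of_span_closed
    (hS : ∀ r : S, ∀ s : Finset S, (r : PowSer n) ∈ Ideal.span (Subtype.val '' (s : Set S)) →
      r ∈ Ideal.span (s : Set S)) (I : Ideal S) : (I.map S.subtype).comap S.subtype = I := by
  refine le_antisymm (fun r hr => ?_) Ideal.le_comap_map
  obtain ⟨t, ht, hrt⟩ := Submodule.mem_span_finite_of_mem_span hr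
  classical
  obtain ⟨s, hs, rfl⟩ := Finset.subset_set_image_iff.1 ht
  refine Ideal.span_le.2 hs (hS r s ?_)
  rw [Finset.coe_image] at hrt
  exact hrt

/-- Extension embeds the ideals of `S` strictly monotonically into those of the Noetherian ring `T`.
-/
theorem isNoetherianRing_of_comap_map_eq
    (hS : ∀ I : Ideal S, (I.map S.subtype).comap S.subtype = I) : IsNoetherianRing S := by
  have hmono : StrictMono fun I : Ideal S => I.map S.subtype := by
    refine (show Monotone fun I : Ideal S => I.map S.subtype from
      fun _ _ h => Ideal.map_mono h).strictMono_of_injective fun I J h => ?_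
    rw [← hS I, ← hS J]
    exact congrArg _ h
  exact isNoetherian_iff'.2 hmono.wellFoundedGT

theorem map_comap_maxIdealT (hX : ∀ j, (MvPowerSeries.X j : PowSer n) ∈ S) :
    ((maxIdealT n).comap S.subtype).map S.subtype = maxIdealT n := by
  refine le_antisymm Ideal.map_comap_le (Ideal.span_le.2 ?_)
  rintro _ ⟨j, rfl⟩
  exact Ideal.mem_map_of_mem S.subtype
    (show (⟨_, hX j⟩ : S) ∈ (maxIdealT n).comap S.subtype from X_mem_maxIdealT j)

theorem exists_sub_mem_pow
    (hX : ∀ j, (MvPowerSeries.X j : PowSer n) ∈ S)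
    (hC : ∀ q : ℚ, (MvPowerSeries.C q : PowSer n) ∈ S) (k : ℕ) (t : PowSer n) :
    ∃ s : S, t - s ∈ maxIdealT n ^ k := by
  induction k generalizing t with
  | zero => exact ⟨0, by simp⟩
  | succ k ih =>
    have key : ∀ y ∈ maxIdealT n ^ k, ∃ s : S, y - s ∈ maxIdealT n ^ (k + 1) := by
      intro y hy
      rw [← map_comap_maxIdealT hX, ← Ideal.map_pow] at hy
      refine Submodule.closure_induction ?_ ?_ ?_ hy
      · exact ⟨0, by simp⟩
      · rintro a b - - ⟨s, hs⟩ ⟨s', hs'⟩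
        refine ⟨s + s', ?_⟩
        rw [Subring.coe_add, add_sub_add_comm]
        exact add_mem hs hs'
      · rintro a _ ⟨s, hs, rfl⟩
        -- Modulo `M` the coefficient `a` equals its constant term, and `s` is already in `M ^ k`.
        refine ⟨⟨_, hC (MvPowerSeries.constantCoeff a)⟩ * s, ?_⟩
        rw [Subring.coe_mul, smul_eq_mul, Subring.coe_subtype, ← sub_mul, pow_succ']
        refine Ideal.mul_mem_mul ?_ ?_
        · simp [mem_maxIdealT_iff]
        · rw [← map_comap_maxIdealT hX, ← Ideal.map_pow]
          exact Ideal.mem_map_of_mem S.subtype hs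
    obtain ⟨s, hs⟩ := ih t
    obtain ⟨s', hs'⟩ := key _ hs
    exact ⟨s + s', by rw [Subring.coe_add, ← sub_sub]; exact hs'⟩

/-- Contractedness gives `m ^ k = M ^ k ∩ S`, so each `S / m ^ k → T / M ^ k` is injective; density
of `S` gives surjectivity in the limit. -/
theorem nonempty_adicCompletion_algEquiv
    (hX : ∀ j, (MvPowerSeries.X j : PowSer n) ∈ S)
    (hC : ∀ q : ℚ, (MvPowerSeries.C q : PowSer n) ∈ S)
    (hS : ∀ I : Ideal S, (I.map S.subtype).comap S.subtype = I) :
    Nonempty (AdicCompletion ((maxIdealT n).comap S.subtype) S ≃ₐ[S] PowSer n) := by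
  set m := (maxIdealT n).comap S.subtype with hm
  have hpow : ∀ k, m ^ k = (maxIdealT n ^ k).comap (algebraMap S (PowSer n)) := by
    intro k
    rw [← map_comap_maxIdealT hX, ← Ideal.map_pow]
    exact (hS (m ^ k)).symm
  let f : (k : ℕ) → AdicCompletion m S →ₐ[S] PowSer n ⧸ maxIdealT n ^ k := fun k =>
    (Ideal.quotientMapₐ (maxIdealT n ^ k) (Algebra.ofId S (PowSer n)) (hpow k).le).comp
      (AdicCompletion.evalₐ m k)
  have hf : ∀ {j k : ℕ} (hle : j ≤ k),
      (Ideal.Quotient.factorₐ S (Ideal.pow_le_pow_right hle)).comp (f k) = f j := by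
    intro j k hle
    refine AlgHom.ext fun x => ?_
    induction x using AdicCompletion.induction_on with
    | h x =>
      have hx := Ideal.Quotient.eq.1 (AdicCompletion.Ideal.mk_eq_mk m hle x)
      rw [hpow j] at hx
      simp only [f, AlgHom.comp_apply, AdicCompletion.evalₐ_mk]
      exact Ideal.Quotient.eq.2 hx
  let F := IsAdicComplete.liftAlgHom (maxIdealT n) f hf
  have hF : ∀ k x, Ideal.Quotient.mk (maxIdealT n ^ k) (F x) = f k x :=
    fun k x => IsAdicComplete.mk_liftAlgHom _ f hf k x
  refine ⟨AlgEquiv.ofBijective F ⟨(injective_iff_map_eq_zero F).2 fun x hx => ?_, fun t => ?_⟩⟩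
  · refine AdicCompletion.ext_evalₐ fun k => ?_
    have h := hF k x
    rw [hx, map_zero] at h
    have hinj : Function.Injective (Ideal.quotientMapₐ (maxIdealT n ^ k)
        (Algebra.ofId S (PowSer n)) (hpow k).le) :=
      Ideal.quotientMap_injective' (H := (hpow k).le) (hpow k).ge
    rw [map_zero]
    exact hinj (h.symm.trans (map_zero _).symm)
  · choose s hs using fun k => exists_sub_mem_pow hX hC k t
    have hcau : ∀ k, s k ≡ s (k + 1) [SMOD (m ^ k • ⊤ : Ideal S)] := by
      intro k
      rw [SModEq.sub_mem, smul_eq_mul, Ideal.mul_top, hpow k]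
      have h := sub_mem (Ideal.pow_le_pow_right k.le_succ (hs (k + 1))) (hs k)
      rwa [sub_sub_sub_cancel_left] at h
    refine ⟨AdicCompletion.mk m S (AdicCompletion.AdicCauchySequence.mk m S s hcau),
      sub_eq_zero.1 (eq_zero_of_forall_mem_pow fun k => ?_)⟩
    rw [← Ideal.Quotient.eq, hF]
    refine Eq.trans ?_ (Ideal.Quotient.eq.2 (hs k)).symm
    simp only [f, AlgHom.comp_apply, AdicCompletion.evalₐ_mk]
    rfl

end Closed

theorem exists_isBaseRing (n : ℕ) : ∃ S : Subring (PowSer n), IsBaseRing S := by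
  classical
  have : IsDomain (PowSer n) := NoZeroDivisors.to_isDomain _
  have hcoeff : ∀ (r : PowSer n) (s : Finset (PowSer n)), ∃ c : PowSer n → PowSer n,
      r ∈ Ideal.span (s : Set (PowSer n)) → ∑ a ∈ s, c a * a = r := by
    intro r s
    by_cases h : r ∈ Ideal.span (s : Set (PowSer n))
    · obtain ⟨c, -, hc⟩ := Submodule.mem_span_finset.1 h
      exact ⟨c, fun _ => hc⟩
    · exact ⟨0, fun h' => absurd h' h⟩
  choose c hc using hcoeff
  have hfac : ∀ r : PowSer n, ∃ s : Set (PowSer n), s.Countable ∧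
      (r ≠ 0 → ∀ p, Prime p → p ∣ r → ∃ q ∈ s, Associated p q) := by
    intro r
    by_cases hr : r = 0
    · exact ⟨∅, Set.countable_empty, fun h => absurd hr h⟩
    · obtain ⟨s, hs, h⟩ := exists_countable_prime_factors r hr
      exact ⟨s, hs, fun _ => h⟩
  choose d hd hdp using hfac
  obtain ⟨S', hXS, hScount, hScl⟩ := exists_countable_closed_subalgebra
    (Set.range fun j => (MvPowerSeries.X j : PowSer n)) (Set.countable_range _)
    -- Closure under `c` makes every ideal of `S` contracted from `T`; closure under `d` gives the
    -- factor condition.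
    (fun r s => c r s '' s ∪ d r) fun r s => (s.countable_toSet.image _).union (hd r)
  let S : Subring (PowSer n) := S'.toSubring
  have hX : ∀ j, (MvPowerSeries.X j : PowSer n) ∈ S := fun j => hXS ⟨j, rfl⟩
  have hC : ∀ q : ℚ, (MvPowerSeries.C q : PowSer n) ∈ S := fun q => S'.algebraMap_mem q
  have hspan : ∀ r : S, ∀ s : Finset S,
      (r : PowSer n) ∈ Ideal.span (Subtype.val '' (s : Set S)) →
      r ∈ Ideal.span (s : Set S) := by
    intro r s hr
    have himg : ((s.map (Function.Embedding.subtype _) : Finset (PowSer n)) : Set (PowSer n)) =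
      Subtype.val '' (s : Set S) := by simp
    rw [← himg] at hr
    have hsS : ((s.map (Function.Embedding.subtype _) : Finset (PowSer n)) : Set (PowSer n)) ⊆
        S' := by
      rw [himg]
      rintro _ ⟨a, -, rfl⟩
      exact a.2
    have hsum := hc _ _ hr
    have hmem : ∀ a ∈ s, c r (s.map (Function.Embedding.subtype _)) a ∈ S := fun a ha =>
      hScl r r.2 _ hsS (Or.inl ⟨a, by simpa using ha, rfl⟩)
    rw [Finset.sum_map, ← Finset.sum_attach] at hsum
    have hr' : r = ∑ a ∈ s.attach, (⟨_, hmem a a.2⟩ : S) * a := by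
      refine Subtype.ext (hsum.symm.trans ?_)
      simp
    rw [hr']
    exact Ideal.sum_mem _ fun a _ => Ideal.mul_mem_left _ _ (Ideal.subset_span a.2)
  have hcontr := comap_map_eq_of_span_closed hspan
  refine ⟨S, hScount, isNoetherianRing_of_comap_map_eq hcontr,
    isQuasiLocalSub_of_forall_exists_inv fun x hx hxM => ?_, ?_,
    nonempty_adicCompletion_algEquiv hX hC hcontr, fun r hr hr0 p hp hpr => ?_⟩
  -- A unit `x` of `T` in `S` has `1 ∈ xT ∩ S = xS`.
  · have h1 : ((1 : S) : PowSer n) ∈ Ideal.span (Subtype.val '' (({⟨x, hx⟩} : Finset S) : Set S)) := by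
      rw [Finset.coe_singleton, Set.image_singleton,
        Ideal.span_singleton_eq_top.2 (isUnit_iff_notMem_maxIdealT.2 hxM)]
      trivial
    have h2 := hspan _ _ h1
    rw [Finset.coe_singleton] at h2
    obtain ⟨y, hy⟩ := Ideal.mem_span_singleton.1 h2
    exact ⟨y, y.2, congrArg Subtype.val hy.symm⟩
  · rintro _ ⟨f, rfl⟩
    induction f using MvPolynomial.induction_on with
    | C a => simpa using hC a
    | add p q hp hq => rw [map_add]; exact add_mem hp hq
    | mul_X p j hp =>
      rw [map_mul]
      refine mul_mem hp ?_
      simpa using hX j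
  · obtain ⟨q, hq, v, hv⟩ := hdp r hr0 p hp (Ideal.mem_span_singleton.1 hpr)
    refine ⟨v, v.isUnit, ?_⟩
    rw [hv]
    exact hScl r hr ∅ (by simp) (Or.inr hq)

/-! ### Admissible sequences, directed unions and the `ω₁`-chain -/

theorem IsBaseRing.X_mem {n : ℕ} {S : Subring (PowSer n)} (hS : IsBaseRing S) (j : Fin n) :
    (MvPowerSeries.X j : PowSer n) ∈ S :=
  hS.polynomials_le ⟨MvPolynomial.X j, MvPolynomial.coe_X j⟩

theorem IsBaseRing.isCSStarSubring {n : ℕ} {S : Subring (PowSer n)} (hS : IsBaseRing S) :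
    IsCSStarSubring S S :=
  ⟨hS.countable, hS.quasiLocal, le_rfl, fun _ _ h => h⟩

theorem le_order_of_mem_maxIdealT_pow {n k : ℕ} {f : PowSer n} (hf : f ∈ maxIdealT n ^ k) :
    (k : ℕ∞) ≤ f.order := by
  induction k generalizing f with
  | zero => simp
  | succ k ih =>
    rw [pow_succ] at hf
    induction hf using Submodule.mul_induction_on' with
    | mem_mul_mem a ha b hb =>
      refine le_trans ?_ MvPowerSeries.le_order_mul
      rw [Nat.cast_succ]
      exact add_le_add (ih ha)
        ((MvPowerSeries.one_le_order_iff_constCoeff_eq_zero).2 ((mem_maxIdealT_iff b).1 hb))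
    | add a _ b _ ha hb => exact (le_min ha hb).trans MvPowerSeries.min_order_le_add

theorem X_pow_notMem_maxIdealT_pow {n a b : ℕ} (x : Fin n) (hab : a < b) :
    (MvPowerSeries.X x : PowSer n) ^ a ∉ maxIdealT n ^ b := by
  intro h
  have h1 := le_order_of_mem_maxIdealT_pow h
  rw [MvPowerSeries.X_pow_eq, MvPowerSeries.order_monomial_of_ne_zero one_ne_zero,
    Finsupp.degree_single] at h1
  exact absurd (Nat.cast_le.1 h1) (not_le.2 hab)

/-- Provides an admissible sequence at every stage of the chain; the exponent starts at `1` to stay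
inside `varIdeal R`. -/
theorem isAdmissible_X_pow {n : ℕ} {R : Subring (PowSer n)} (x : Fin n)
    (hx : (MvPowerSeries.X x : PowSer n) ∈ R) :
    IsAdmissible fun i => (⟨MvPowerSeries.X x, hx⟩ : R) ^ (i + 1) := by
  have hmem : (⟨MvPowerSeries.X x, hx⟩ : R) ∈ varIdeal R := Ideal.subset_span ⟨x, rfl⟩
  refine ⟨fun i => Ideal.pow_mem_of_mem _ hmem _ i.succ_pos,
    fun i j hij => ⟨i + 1, ?_, ?_⟩⟩
  · exact Ideal.pow_mem_pow (X_mem_maxIdealT x) _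
  · exact X_pow_notMem_maxIdealT_pow x (Nat.succ_lt_succ hij)

/-- For every admissible sequence there is an adjoinable unit, and it can be chosen outside `R`. -/
theorem exists_isAdjoinableUnit {n : ℕ} (x : Fin n) {S R : Subring (PowSer n)}
    (hx : (MvPowerSeries.X x : PowSer n) ∈ S) (hR : IsCSStarSubring S R) {A : ℕ → R}
    (hA : IsAdmissible A) :
    ∃ (z : ℕ → S) (u : PowSer n), IsAdjoinableUnit S R A z u ∧ u ∉ R := by
  have := hR.countable
  obtain ⟨z, u, hz, hz0, hu, hsum, hf⟩ := exists_generic_unit x hx hR.sStar.le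
    (isSStarSubring_iff.1 hR.sStar).2 A hA.2
  refine ⟨z, u, ⟨hz, hz0, hu, hsum,
    adjoinLocal_isCSStarSubring hR.sStar.le fun f h => (hf f h).2⟩, fun huR => ?_⟩
  -- If `u` were in `R`, the nonzero polynomial `X - u` over `R` would vanish at `u`.
  exact (hf (X - C ⟨u, huR⟩) (X_sub_C_ne_zero _)).1
    (by rw [map_sub, aeval_X, aeval_C]; exact sub_self u)

section Union

variable {n : ℕ} {S : Subring (PowSer n)} {ι : Type*} [Nonempty ι] {K : ι → Subring (PowSer n)}

theorem iSup_isQuasiLocalSub (hd : Directed (· ≤ ·) K) (hK : ∀ i, IsQuasiLocalSub (K i)) :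
    IsQuasiLocalSub (iSup K) := by
  refine isQuasiLocalSub_of_forall_exists_inv fun x hx hxM => ?_
  obtain ⟨i, hi⟩ := (Subring.mem_iSup_of_directed hd).1 hx
  obtain ⟨y, hy, hxy⟩ := (hK i).exists_inv hi hxM
  exact ⟨y, le_iSup K i hy, hxy⟩

theorem iSup_isSStarSubring (hd : Directed (· ≤ ·) K) (hK : ∀ i, IsSStarSubring S (K i)) :
    IsSStarSubring S (iSup K) := by
  refine isSStarSubring_iff.2 ⟨(hK (Classical.arbitrary ι)).le.trans (le_iSup K _),
    fun r hr => ?_⟩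
  obtain ⟨i, hi⟩ := (Subring.mem_iSup_of_directed hd).1 hr
  exact (isSStarSubring_iff.1 (hK i)).2 r hi

theorem iSup_isCSStarSubring [Countable ι] (hd : Directed (· ≤ ·) K)
    (hK : ∀ i, IsCSStarSubring S (K i)) : IsCSStarSubring S (iSup K) := by
  refine ⟨?_, iSup_isQuasiLocalSub hd fun i => (hK i).quasiLocal,
    iSup_isSStarSubring hd fun i => (hK i).sStar⟩
  have h : (⋃ i, (K i : Set (PowSer n))).Countable :=
    Set.countable_iUnion fun i => (hK i).countable
  rw [← Subring.coe_iSup_of_directed hd] at h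
  exact h

end Union

open Classical in
/-- Adjoin to `R`, if possible, a unit outside `R` and localize. -/
def unitStep {n : ℕ} (S R : Subring (PowSer n)) : Subring (PowSer n) :=
  -- The default `R` makes the step increasing for every `R`, so the chain is monotone on all
  -- ordinals; below `ω₁` the default is not taken.
  if h : ∃ (u : PowSer n) (A : ℕ → R) (z : ℕ → S),
    IsAdmissible A ∧ IsAdjoinableUnit S R A z u ∧ u ∉ R
  then adjoinLocal R h.choose else R

theorem le_unitStep {n : ℕ} (S R : Subring (PowSer n)) : R ≤ unitStep S R := by
  unfold unitStep
  split_ifs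
  exacts [le_adjoinLocal _ _, le_rfl]

theorem unitStep_spec {n : ℕ} (x : Fin n) {S R : Subring (PowSer n)}
    (hx : (MvPowerSeries.X x : PowSer n) ∈ S) (hR : IsCSStarSubring S R) :
    ∃ (A : ℕ → R) (z : ℕ → S) (u : PowSer n), IsAdmissible A ∧ IsAdjoinableUnit S R A z u ∧
      u ∉ R ∧ unitStep S R = adjoinLocal R u := by
  have hA := isAdmissible_X_pow x (hR.sStar.le hx)
  obtain ⟨z, u, hu, huR⟩ := exists_isAdjoinableUnit x hx hR hA
  have h : ∃ (u : PowSer n) (A : ℕ → R) (z : ℕ → S),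
      IsAdmissible A ∧ IsAdjoinableUnit S R A z u ∧ u ∉ R := ⟨u, _, z, hA, hu, huR⟩
  obtain ⟨A, z, hA, hz, hn⟩ := h.choose_spec
  exact ⟨A, z, _, hA, hz, hn, dif_pos h⟩

/-- Transfinite iteration of `unitStep`. -/
def unitChain {n : ℕ} (S : Subring (PowSer n)) (c : Ordinal.{0}) : Subring (PowSer n) :=
  Ordinal.limitRecOn c S (fun _ R => unitStep S R) fun o _ R => ⨆ b : Set.Iio o, R b b.2

section Chain

variable {n : ℕ} (S : Subring (PowSer n))

theorem unitChain_zero : unitChain S 0 = S := Ordinal.limitRecOn_zero ..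

theorem unitChain_succ (c : Ordinal.{0}) :
    unitChain S (Order.succ c) = unitStep S (unitChain S c) := by
  rw [Order.succ_eq_add_one]
  exact Ordinal.limitRecOn_add_one ..

theorem unitChain_limit {c : Ordinal.{0}} (hc : Order.IsSuccLimit c) :
    unitChain S c = ⨆ b : Set.Iio c, unitChain S b :=
  Ordinal.limitRecOn_limit _ _ _ _ hc

theorem unitChain_mono : Monotone (unitChain S) := by
  intro b c
  induction c using Ordinal.limitRecOn with
  | zero => exact fun h => (le_antisymm h (zero_le)).symm ▸ le_rfl
  | add_one c ih =>
    intro h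
    rcases h.lt_or_eq with h | rfl
    · rw [← Order.succ_eq_add_one] at h ⊢
      rw [unitChain_succ]
      exact (ih (Order.lt_succ_iff.1 h)).trans (le_unitStep _ _)
    · exact le_rfl
  | limit c hc ih =>
    intro h
    rcases h.lt_or_eq with h | rfl
    · rw [unitChain_limit S hc]
      exact le_iSup (fun b : Set.Iio c => unitChain S b) ⟨b, h⟩
    · exact le_rfl

theorem unitChain_directed (c : Ordinal.{0}) :
    Directed (· ≤ ·) fun b : Set.Iio c => unitChain S b :=
  Monotone.directed_le fun _ _ h => unitChain_mono S h

theorem coe_unitChain_limit {c : Ordinal.{0}} (hc : Order.IsSuccLimit c) :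
    (unitChain S c : Set (PowSer n)) = ⋃ b < c, (unitChain S b : Set (PowSer n)) := by
  have : Nonempty (Set.Iio c) := ⟨⟨0, hc.bot_lt⟩⟩
  rw [unitChain_limit S hc, Subring.coe_iSup_of_directed (unitChain_directed S c),
    Set.iUnion_subtype]
  rfl

theorem countable_Iio_ordinal_iff {c : Ordinal.{0}} :
    Countable (Set.Iio c) ↔ c < Ordinal.omega 1 := by
  rw [← Cardinal.mk_le_aleph0_iff, Cardinal.mk_Iio_ordinal, ← Cardinal.lift_aleph0.{1, 0},
    Cardinal.lift_le, ← Cardinal.ord_aleph, Cardinal.lt_ord, ← Cardinal.succ_aleph0,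
    Order.lt_succ_iff]

variable {S}

theorem unitChain_isCSStarSubring (hS : IsBaseRing S) (x : Fin n) (c : Ordinal.{0})
    (hc : c < Ordinal.omega 1) : IsCSStarSubring S (unitChain S c) := by
  induction c using Ordinal.limitRecOn with
  | zero => rw [unitChain_zero]; exact hS.isCSStarSubring
  | add_one c ih =>
    rw [← Order.succ_eq_add_one] at hc ⊢
    obtain ⟨A, z, u, -, hu, -, h⟩ :=
      unitStep_spec x (hS.X_mem x) (ih ((Order.lt_succ c).trans hc))
    rw [unitChain_succ, h]
    exact hu.csStar
  | limit c hlim ih =>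
    have : Nonempty (Set.Iio c) := ⟨⟨0, hlim.bot_lt⟩⟩
    have := countable_Iio_ordinal_iff.2 hc
    rw [unitChain_limit S hlim]
    exact iSup_isCSStarSubring (unitChain_directed S c) fun b => ih b b.2 (b.2.trans hc)

theorem isUnitChain_unitChain (hS : IsBaseRing S) (x : Fin n) :
    IsUnitChain S (unitChain S) where
  zero := unitChain_zero S
  csStar := unitChain_isCSStarSubring hS x
  succ c hc := by
    rw [unitChain_succ]
    exact unitStep_spec x (hS.X_mem x) (unitChain_isCSStarSubring hS x c hc)
  limit _ _ hlim := coe_unitChain_limit S hlim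

theorem isSuccLimit_omega_one : Order.IsSuccLimit (Ordinal.omega.{0} 1) := by
  rw [← Cardinal.ord_aleph]
  exact Cardinal.isSuccLimit_ord (Cardinal.aleph0_le_aleph 1)

/-- Choosing at each stage below `ω₁` an element that is new at its successor embeds the countable
ordinals in the union. -/
theorem uncountable_unitChain_omega_one (hS : IsBaseRing S) (x : Fin n) :
    Uncountable (unitChain S (Ordinal.omega 1)) := by
  have hu : ∀ c : Set.Iio (Ordinal.omega.{0} 1), ∃ u : unitChain S (Ordinal.omega 1),
      (u : PowSer n) ∈ unitChain S (Order.succ c.1) ∧ (u : PowSer n) ∉ unitChain S c.1 := by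
    intro c
    obtain ⟨A, z, u, -, -, hu, h⟩ := (isUnitChain_unitChain hS x).succ c c.2
    have hmem : u ∈ unitChain S (Order.succ c.1) := h ▸ mem_adjoinLocal_self _ u
    exact ⟨⟨u, unitChain_mono S (Order.succ_le_of_lt c.2) hmem⟩, hmem, hu⟩
  choose u hu hu' using hu
  have hlt : ∀ b c, b < c → u b ≠ u c := fun b c hbc h =>
    hu' c (h ▸ unitChain_mono S (Order.succ_le_of_lt hbc) (hu b))
  have hinj : Function.Injective u := fun b c h => by
    rcases lt_trichotomy b c with hbc | hbc | hbc
    exacts [(hlt b c hbc h).elim, hbc, (hlt c b hbc h.symm).elim]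
  by_contra hne
  rw [not_uncountable_iff] at hne
  exact lt_irrefl _ (countable_Iio_ordinal_iff.1 hinj.countable)

end Chain

/-! ### Fractions inside `T` and the main theorem -/

/-- The intersection of the fraction field of `A` with `T`. -/
def fractionsIn {n : ℕ} (A : Subring (PowSer n)) : Subring (PowSer n) where
  carrier := {b | ∃ a ∈ A, a ≠ 0 ∧ a * b ∈ A}
  one_mem' := ⟨1, A.one_mem, one_ne_zero, by simp⟩
  zero_mem' := ⟨1, A.one_mem, one_ne_zero, by simp⟩
  mul_mem' := by
    rintro b c ⟨s, hs, hs0, hb⟩ ⟨t, ht, ht0, hc⟩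
    refine ⟨s * t, mul_mem hs ht, mul_ne_zero hs0 ht0, ?_⟩
    rw [mul_mul_mul_comm]
    exact mul_mem hb hc
  add_mem' := by
    rintro b c ⟨s, hs, hs0, hb⟩ ⟨t, ht, ht0, hc⟩
    refine ⟨s * t, mul_mem hs ht, mul_ne_zero hs0 ht0, ?_⟩
    rw [show s * t * (b + c) = t * (s * b) + s * (t * c) by ring]
    exact add_mem (mul_mem ht hb) (mul_mem hs hc)
  neg_mem' := by
    rintro b ⟨s, hs, hs0, hb⟩
    exact ⟨s, hs, hs0, by rw [mul_neg]; exact neg_mem hb⟩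

section Fractions

variable {n : ℕ} {S A : Subring (PowSer n)}

theorem le_fractionsIn (A : Subring (PowSer n)) : A ≤ fractionsIn A := fun a ha =>
  ⟨1, A.one_mem, one_ne_zero, by rwa [one_mul]⟩

/-- Here `t = (b * t) / b` is a fraction that lies in `T`. Both quasi-locality of `B` and `bT ∩ B =
bB` come from this. -/
theorem mem_fractionsIn_of_mul_mem {b t : PowSer n} (hb : b ∈ fractionsIn A) (hb0 : b ≠ 0)
    (hbt : b * t ∈ fractionsIn A) : t ∈ fractionsIn A := by
  obtain ⟨s, hs, hs0, hsb⟩ := hb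
  obtain ⟨r, hr, hr0, hrb⟩ := hbt
  refine ⟨r * (s * b), mul_mem hr hsb, mul_ne_zero hr0 (mul_ne_zero hs0 hb0), ?_⟩
  rw [show r * (s * b) * t = s * (r * (b * t)) by ring]
  exact mul_mem hs hrb

theorem fractionsIn_isQuasiLocalSub (A : Subring (PowSer n)) :
    IsQuasiLocalSub (fractionsIn A) := by
  refine isQuasiLocalSub_of_forall_exists_inv fun x hx hxM => ?_
  obtain ⟨y, hy⟩ := (isUnit_iff_notMem_maxIdealT.2 hxM).exists_right_inv
  refine ⟨y, mem_fractionsIn_of_mul_mem hx ?_ (hy.symm ▸ one_mem _), hy⟩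
  rintro rfl
  exact hxM (Ideal.zero_mem _)

theorem fractionsIn_isSStarSubring (hA : IsSStarSubring S A) :
    IsSStarSubring S (fractionsIn A) := by
  refine isSStarSubring_iff.2 ⟨hA.le.trans (le_fractionsIn A), ?_⟩
  rintro b ⟨a, ha, ha0, hab⟩ hb0
  obtain ⟨s, hs, hs0, hd⟩ := (isSStarSubring_iff.1 hA).2 _ hab (mul_ne_zero ha0 hb0)
  exact ⟨s, hs, hs0, (Dvd.intro_left a rfl).trans hd⟩

theorem fractionsIn_comap_span_singleton (b : fractionsIn A) :
    (Ideal.span {(b : PowSer n)}).comap (fractionsIn A).subtype = Ideal.span {b} := by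
  refine le_antisymm (fun r hr => ?_) ?_
  · obtain ⟨t, ht⟩ := Ideal.mem_span_singleton.1 (Ideal.mem_comap.1 hr)
    have ht' : (r : PowSer n) = b * t := ht
    by_cases hb0 : (b : PowSer n) = 0
    · rw [hb0, zero_mul] at ht'
      rw [show r = 0 from Subtype.ext ht']
      exact Ideal.zero_mem _
    · have htm := mem_fractionsIn_of_mul_mem b.2 hb0 (ht' ▸ r.2)
      exact Ideal.mem_span_singleton.2 ⟨⟨t, htm⟩, Subtype.ext ht'⟩
  · rw [Ideal.span_le, Set.singleton_subset_iff]
    exact Ideal.mem_span_singleton_self (b : PowSer n)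

end Fractions

end

theorem mainTheorem3 (n : ℕ) (hn : 2 ≤ n) :
    (∃ S : Subring (PowSer n), IsBaseRing S) ∧
    ∀ S : Subring (PowSer n), IsBaseRing S →
      (∀ R : Subring (PowSer n), IsCSStarSubring S R → ∀ A : ℕ → R, IsAdmissible A →
        ∃ (z : ℕ → S) (u : PowSer n), IsAdjoinableUnit S R A z u) ∧
      ∃ (R : Ordinal.{0} → Subring (PowSer n)) (A B : Subring (PowSer n)),
        IsUnitChain S R ∧
        (A : Set (PowSer n)) = ⋃ c < Ordinal.omega 1, (R c : Set (PowSer n)) ∧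
        Uncountable A ∧ IsQuasiLocalSub A ∧ IsSStarSubring S A ∧
        A ≤ B ∧ (∀ b ∈ B, ∃ a ∈ A, a ≠ 0 ∧ a * b ∈ A) ∧
        Uncountable B ∧ IsQuasiLocalSub B ∧ IsSStarSubring S B ∧
        ∀ b : B, (Ideal.span {(b : PowSer n)}).comap B.subtype = Ideal.span {b} := by
  refine ⟨exists_isBaseRing n, fun S hS => ?_⟩
  let x : Fin n := ⟨0, by omega⟩
  have hlim := isSuccLimit_omega_one
  have hstar := unitChain_isCSStarSubring hS x
  have hne : Nonempty (Set.Iio (Ordinal.omega.{0} 1)) := ⟨⟨0, hlim.bot_lt⟩⟩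
  have hunc := uncountable_unitChain_omega_one hS x
  -- As `ω₁` is a limit ordinal, the chain's own value there is the union of the earlier stages and
  -- serves as `A`.
  have hAS : IsSStarSubring S (unitChain S (Ordinal.omega 1)) := by
    rw [unitChain_limit S hlim]
    exact iSup_isSStarSubring (unitChain_directed S _) fun b => (hstar b b.2).sStar
  refine ⟨fun R hR A hA => ?_, unitChain S, unitChain S (Ordinal.omega 1),
    fractionsIn (unitChain S (Ordinal.omega 1)), isUnitChain_unitChain hS x,
    coe_unitChain_limit S hlim, hunc, ?_, hAS, le_fractionsIn _, fun b hb => hb,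
    (Subring.inclusion_injective (le_fractionsIn _)).uncountable,
    fractionsIn_isQuasiLocalSub _, fractionsIn_isSStarSubring hAS,
    fractionsIn_comap_span_singleton⟩
  · obtain ⟨z, u, hu, -⟩ := exists_isAdjoinableUnit x (hS.X_mem x) hR hA
    exact ⟨z, u, hu⟩
  · rw [unitChain_limit S hlim]
    exact iSup_isQuasiLocalSub (unitChain_directed S _) fun b => (hstar b b.2).quasiLocal
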